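/- Fix pairwise disjoint countably infinite sets $\mathrm{Att}$, $\mathrm{Const}$, $\mathrm{Rel}$ of attributes, constants and relation names, where every relation name $R$ comes with a finite set $\mathrm{Att}(R)\subseteq\mathrm{Att}$. Let $\mathbb K=(K,\oplus,0)$ be a commutative monoid that is positive ($a\oplus b=0$ implies $a=b=0$) and weakly absorptive ($a\oplus b=b$ for some non-zero $a,b\in K$), with natural preorder $a\le b \iff \exists c\colon a\oplus c=b$. A $\mathbb K$-database $\mathfrak D$ over a finite set $\mathbf S\subseteq \mathrm{Rel}$ assigns to each $R\in\mathbf S$ a function $R^{\mathfrak D}$ of finite support from the set of tuples $t\colon \mathrm{Att}(R)\to\mathrm{Const}$ to $K$. For pairwise distinct $A_1,\dots,A_n\in\mathrm{Att}(R)$ and $\vec a\in\mathrm{Const}^n$ put $R^{\mathfrak D}[A_1,\dots,A_n](\vec a)=\bigoplus\{R^{\mathfrak D}(t) : t(A_i)=a_i \text{ for all } i\}$ (summing over tuples $t$, with multiplicity of values). An inclusion dependency (IND) is an expression $R[A_1,\dots,A_n]\le S[B_1,\dots,B_n]$ with $n\ge 0$, pairwise distinct $A_i\in\mathrm{Att}(R)$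 and pairwise distinct $B_i\in\mathrm{Att}(S)$; $\mathfrak D$ satisfies it if $R^{\mathfrak D}[A_1,\dots,A_n](\vec a)\le S^{\mathfrak D}[B_1,\dots,B_n](\vec a)$ for all $\vec a\in\mathrm{Const}^n$. For a finite set $\Sigma\cup\{\tau\}$ of INDs, write $\Sigma\models_{\mathbb K}\tau$ if every $\mathbb K$-database (over a schema containing the relation names in $\Sigma\cup\{\tau\}$) that satisfies all members of $\Sigma$ satisfies $\tau$. Write $\Sigma\vdash\tau$ if $\tau$ is derivable from $\Sigma$ by the three standard rules: - Reflexivity: derive $R[A_1,\dots,A_n]\le R[A_1,\dots,A_n]$, for pairwise distinct $A_1,\dots,A_n\in\mathrm{Att}(R)$. - Transitivity: from $R[\vec A]\le S[\vec B]$ and $S[\vec B]\le T[\vec C]$ derive $R[\vec A]\le T[\vec C]$. - Projection and permutation: from $R[A_1,\dots,A_n]\le S[B_1,\dots,B_n]$ derive $R[A_{i_1},\dots,A_{i_\ell}]\le S[B_{i_1},\dots,B_{i_\ell}]$, for distinct $i_1,\dots,i_\ell\in\{1,\dots,n\}$ (with $\ell\ge 0$). **Theorem.** These rules are sound and complete over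 $\mathbb K$-databases: for every finite set $\Sigma\cup\{\tau\}$ of INDs, $\Sigma\vdash\tau$ implies $\Sigma\models_{\mathbb K}\tau$ (soundness), and $\Sigma\models_{\mathbb K}\tau$ implies $\Sigma\vdash\tau$ (completeness). -/

import Mathlib

namespace KInd

/-! ### Commutative monoids -/

section Monoid

variable (K : Type*) [AddCommMonoid K]

/-- A monoid is positive if `a + b = 0` entails `a = 0 = b`. -/
def IsPositive : Prop := ∀ a b : K, a + b = 0 → a = 0 ∧ b = 0

/-- A monoid is weakly absorptive if `a + b = b` for some non-zero `a` and `b`. -/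
def IsWeaklyAbsorptive : Prop := ∃ a b : K, a ≠ 0 ∧ b ≠ 0 ∧ a + b = b

variable {K}

/-- The natural order (a preorder) of a monoid. -/
def NatLE (a b : K) : Prop := ∃ c : K, a + c = b

end Monoid

/-! ### `K`-relations and `K`-databases -/

/-- Tuples over a finite set `X` of attributes. -/
abbrev Tup {Att : Type*} (Const : Type*) (X : Finset Att) : Type _ := X → Const

/-- `K`-relations over `X`: functions from tuples over `X` to `K` of finite support. -/
abbrev KRelation {Att : Type*} (Const K : Type*) [AddCommMonoid K] (X : Finset Att) : Type _ :=
  Tup Const X →₀ K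

open Classical in
/-- The value `r[A₁, …, Aₙ](a₁, …, aₙ)` of the marginalisation of the `K`-relation `r` to the
pairwise distinct attributes `A₁, …, Aₙ`: the sum of the weights `r t` of all tuples `t` with
`t Aᵢ = aᵢ` for all `i`. It is enough to sum over the (finite) support of `r`. -/
noncomputable def marg {Att Const K : Type*} [AddCommMonoid K] {X : Finset Att}
    (r : KRelation Const K X) {n : ℕ} (A : Fin n ↪ X) (a : Fin n → Const) : K :=
  ∑ t ∈ r.support with ∀ i, t (A i) = a i, r t

/-- A `K`-database over the schema `S`, a finite set of relation names: one `K`-relation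
over `att R` for each relation name `R` in `S`. -/
abbrev KDatabase {Att Rel : Type*} (att : Rel → Finset Att) (Const K : Type*) [AddCommMonoid K]
    (S : Finset Rel) : Type _ :=
  ∀ R : Rel, R ∈ S → KRelation Const K (att R)

/-! ### Inclusion dependencies -/

/-- The inclusion dependency `R[A₁, …, Aₙ] ≤ S[B₁, …, Bₙ]`, where `A₁, …, Aₙ` are pairwise
distinct attributes of `R` and `B₁, …, Bₙ` are pairwise distinct attributes of `S`.
The arity `n` may be zero. -/
structure IND {Att Rel : Type*} (att : Rel → Finset Att) where
  source : Rel
  target : Rel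
  arity : ℕ
  lhs : Fin arity ↪ att source
  rhs : Fin arity ↪ att target

section Semantics

variable {Att Rel : Type*} {att : Rel → Finset Att}

/-- Both relation names of the inclusion dependency belong to the schema `S`. -/
def IND.IsOver (σ : IND att) (S : Finset Rel) : Prop := σ.source ∈ S ∧ σ.target ∈ S

/-- Satisfaction of an inclusion dependency over `S` by a `K`-database over `S`. -/
def Satisfies {Const K : Type*} [AddCommMonoid K] {S : Finset Rel}
    (D : KDatabase att Const K S) (σ : IND att) : Prop :=
  ∃ (hs : σ.source ∈ S) (ht : σ.target ∈ S), ∀ a : Fin σ.arity → Const,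
    NatLE (marg (D σ.source hs) σ.lhs a) (marg (D σ.target ht) σ.rhs a)

/-- Entailment over `K`-databases (with constants from `Const`): every `K`-database, over any
schema that contains the relation names of `Γ` and `τ`, which satisfies all members of `Γ`,
satisfies `τ`. -/
def Entails (Const K : Type*) [AddCommMonoid K] (Γ : Set (IND att)) (τ : IND att) : Prop :=
  ∀ S : Finset Rel, (∀ σ ∈ Γ, σ.IsOver S) → τ.IsOver S →
    ∀ D : KDatabase att Const K S, (∀ σ ∈ Γ, Satisfies D σ) → Satisfies D τ

/-- Derivability from `Γ` by the three standard rules for inclusion dependencies. -/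
inductive Derivable (Γ : Set (IND att)) : IND att → Prop
  | hyp {σ : IND att} (h : σ ∈ Γ) : Derivable Γ σ
  | reflexivity (R : Rel) {n : ℕ} (A : Fin n ↪ att R) : Derivable Γ ⟨R, R, n, A, A⟩
  | transitivity {R S T : Rel} {n : ℕ} {A : Fin n ↪ att R} {B : Fin n ↪ att S}
      {C : Fin n ↪ att T} (h₁ : Derivable Γ ⟨R, S, n, A, B⟩)
      (h₂ : Derivable Γ ⟨S, T, n, B, C⟩) : Derivable Γ ⟨R, T, n, A, C⟩
  | projection {R S : Rel} {n : ℕ} {A : Fin n ↪ att R} {B : Fin n ↪ att S}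
      (h : Derivable Γ ⟨R, S, n, A, B⟩) {l : ℕ} (i : Fin l ↪ Fin n) :
      Derivable Γ ⟨R, S, l, i.trans A, i.trans B⟩

end Semantics

end KInd

/-!
Soundness is an induction on derivations; the only rule that needs an argument is projection, where
both marginals are sums, over the same finite set of vectors, of the marginals in the premise.

For completeness let `τ = R₀[A₁, …, Aₙ] ≤ S₀[B₁, …, Bₙ]`, let `a + b = b` with `a, b ≠ 0`, and fix
distinct constants `z, w₁, …, wₙ`. The database that refutes a non-derivable `τ` has two layers.

* The `a`-layer (`chaseLayer`) puts weight `a` on the tuple `Cᵢ ↦ wᵢ` (and `z` elsewhere) of a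
  relation `S`, for every `C` such that `R₀[A] ≤ S[C]` is derivable.
* The `b`-layer (`paddingLayer`) puts multiples of `b` on all tuples over `{z, w₁, …, wₙ}` that
  avoid at least one `wᵢ`. The multiples are those of an exchangeable distribution: pick the avoided
  index `i` uniformly, then pick all entries independently and uniformly among the other constants.
  Hence the marginal of the `b`-layer at a vector `v` depends only on `v`, not on the relation and
  the attributes (`margHom_paddingLayer`), so that this layer satisfies every inclusion dependency.

If `v` has an entry outside `z, w₁, …, wₙ`, all marginals at `v` vanish. Otherwise, if `v` misses
some `wᵢ`, then the marginal of the `b`-layer at `v` is a non-zero multiple of `b`, which absorbs all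
`a`s. If `v` contains all `wᵢ`, then the `b`-layer contributes nothing, at most
one tuple of the `a`-layer projects to `v`, and the inclusion dependencies in `Γ` hold because
derivability is closed under projection and transitivity (`margHom_chaseLayer_of_full`). At
`v = (w₁, …, wₙ)` the two sides of `τ` are `a` and `0`, and positivity forbids `a ≤ 0`.
-/

namespace KInd

/-! ### The natural preorder and marginals -/

section Marginals

variable {Att Const K : Type*} [AddCommMonoid K] {X : Finset Att}

theorem NatLE.refl (a : K) : NatLE a a := ⟨0, add_zero a⟩

theorem NatLE.zero_le (a : K) : NatLE 0 a := ⟨a, zero_add a⟩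

theorem NatLE.trans {a b c : K} : NatLE a b → NatLE b c → NatLE a c := by
  rintro ⟨d, rfl⟩ ⟨e, rfl⟩
  exact ⟨d + e, (add_assoc a d e).symm⟩

theorem NatLE.sum {ι : Type*} {s : Finset ι} {f g : ι → K} (h : ∀ i ∈ s, NatLE (f i) (g i)) :
    NatLE (∑ i ∈ s, f i) (∑ i ∈ s, g i) := by
  classical
  choose! c hc using h
  exact ⟨∑ i ∈ s, c i, by rw [← Finset.sum_add_distrib]; exact Finset.sum_congr rfl hc⟩

open Classical in
theorem marg_trans_eq_sum (r : KRelation Const K X) {n l : ℕ} (A : Fin n ↪ X) (i : Fin l ↪ Fin n)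
    (a : Fin l → Const) (F : Finset (Fin n → Const)) (hF : ∀ t ∈ r.support, t ∘ A ∈ F) :
    marg r (i.trans A) a = ∑ b ∈ F with b ∘ i = a, marg r A b := by
  unfold marg
  rw [← Finset.sum_fiberwise_of_maps_to (s := r.support.filter _) (t := F.filter (· ∘ i = a))
    (g := fun t => t ∘ A)]
  · refine Finset.sum_congr rfl fun b hb => Finset.sum_congr ?_ fun _ _ => rfl
    ext t
    simp only [Finset.mem_filter, funext_iff, Function.comp_apply, Function.Embedding.trans_apply]
      at hb ⊢
    constructor
    · rintro ⟨⟨ht, -⟩, h⟩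
      exact ⟨ht, h⟩
    · rintro ⟨ht, h⟩
      exact ⟨⟨ht, fun j => (h _).trans (hb.2 j)⟩, h⟩
  · intro t ht
    rw [Finset.mem_filter] at ht ⊢
    exact ⟨hF t ht.1, funext ht.2⟩

open Classical in
/-- Marginalisation as an additive homomorphism in the `K`-relation. -/
noncomputable def margHom {n : ℕ} (A : Fin n ↪ X) (v : Fin n → Const) :
    KRelation Const K X →+ K :=
  Finsupp.liftAddHom fun t => if ∀ i, t (A i) = v i then AddMonoidHom.id K else 0

theorem margHom_eq_marg (r : KRelation Const K X) {n : ℕ} (A : Fin n ↪ X) (v : Fin n → Const) :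
    margHom A v r = marg r A v := by
  classical
  rw [margHom, Finsupp.liftAddHom_apply, Finsupp.sum, marg, Finset.sum_filter]
  refine Finset.sum_congr (by congr) fun t _ => ?_
  split_ifs <;> rfl

open Classical in
theorem margHom_single {n : ℕ} (A : Fin n ↪ X) (v : Fin n → Const) (t : Tup Const X) (k : K) :
    margHom A v (Finsupp.single t k) = if ∀ i, t (A i) = v i then k else 0 := by
  rw [margHom, Finsupp.liftAddHom_apply_single]
  split_ifs <;> rfl

end Marginals

/-! ### Soundness -/

/-- It suffices that the source of the derived dependency belongs to the schema: derivations never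
leave a schema that contains the relation names of the hypotheses. -/
theorem Derivable.satisfies {Att Rel Const K : Type*} {att : Rel → Finset Att} [AddCommMonoid K]
    {Γ : Set (IND att)} {τ : IND att} {S : Finset Rel} {D : KDatabase att Const K S}
    (h : Derivable Γ τ) (hD : ∀ σ ∈ Γ, Satisfies D σ) (hτ : τ.source ∈ S) : Satisfies D τ := by
  classical
  induction h with
  | hyp h => exact hD _ h
  | reflexivity R A => exact ⟨hτ, hτ, fun a => NatLE.refl _⟩
  | transitivity _ _ ih₁ ih₂ =>
    obtain ⟨h₁, h₂, h⟩ := ih₁ hτ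
    obtain ⟨_, h₃, h'⟩ := ih₂ h₂
    exact ⟨h₁, h₃, fun a => (h a).trans (h' a)⟩
  | @projection R T n A B _ l i ih =>
    obtain ⟨h₁, h₂, h⟩ := ih hτ
    refine ⟨h₁, h₂, fun a => ?_⟩
    let F : Finset (Fin n → Const) :=
      (D R h₁).support.image (· ∘ A) ∪ (D T h₂).support.image (· ∘ B)
    have hA := marg_trans_eq_sum (D R h₁) A i a F fun t ht =>
      Finset.mem_union_left _ (Finset.mem_image_of_mem _ ht)
    have hB := marg_trans_eq_sum (D T h₂) B i a F fun t ht =>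
      Finset.mem_union_right _ (Finset.mem_image_of_mem _ ht)
    change NatLE (marg (D R h₁) (i.trans A) a) (marg (D T h₂) (i.trans B) a)
    rw [hA, hB]
    exact NatLE.sum fun b _ => h b

/-! ### The exchangeable padding layer -/

section Padding

variable {Att Const K : Type*} [AddCommMonoid K]

open Classical in
theorem card_piFinset_filter {X : Finset Att} (V : Finset Const) {m : ℕ} (L : Fin m ↪ X)
    (v : Fin m → Const) (hv : ∀ j, v j ∈ V) :
    ((Fintype.piFinset fun _ : X => V).filter fun t => ∀ j, t (L j) = v j).card
      = V.card ^ (X.card - m) := by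
  have key : ((Fintype.piFinset fun _ : X => V).filter fun t => ∀ j, t (L j) = v j)
      = Fintype.piFinset fun x : X =>
          if x ∈ Finset.univ.map L then V.filter (fun c => ∀ j, L j = x → c = v j) else V := by
    ext t
    simp only [Finset.mem_filter, Fintype.mem_piFinset]
    constructor
    · rintro ⟨h₁, h₂⟩ x
      split_ifs
      · exact Finset.mem_filter.2 ⟨h₁ x, fun j hj => hj ▸ h₂ j⟩
      · exact h₁ x
    · intro h
      refine ⟨fun x => ?_, fun j => ?_⟩
      · have := h x
        split_ifs at this
        · exact (Finset.mem_filter.1 this).1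
        · exact this
      · have := h (L j)
        rw [if_pos (Finset.mem_map_of_mem L (Finset.mem_univ j))] at this
        exact (Finset.mem_filter.1 this).2 j rfl
  have hcard : ∀ x : X, (if x ∈ Finset.univ.map L then
      V.filter (fun c => ∀ j, L j = x → c = v j) else V).card
      = if x ∈ Finset.univ.map L then 1 else V.card := by
    intro x
    split_ifs with hx
    · obtain ⟨j, -, rfl⟩ := Finset.mem_map.1 hx
      refine Finset.card_eq_one.2 ⟨v j, ?_⟩
      ext c
      simp only [Finset.mem_filter, Finset.mem_singleton]
      constructor
      · exact fun h => h.2 j rfl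
      · rintro rfl
        exact ⟨hv j, fun k hk => by rw [L.injective hk]⟩
    · rfl
  rw [key, Fintype.card_piFinset]
  simp only [hcard]
  rw [Finset.prod_ite, Finset.prod_const_one, one_mul, Finset.prod_const, Finset.filter_not,
    Finset.filter_mem_eq_inter, Finset.univ_inter, Finset.card_sdiff_of_subset
      (Finset.subset_univ _), Finset.card_map, Finset.card_univ, Finset.card_univ,
    Fintype.card_coe, Fintype.card_fin]

open Classical in
/-- The constants `z, w₁, …, wₙ` without `wᵢ`. -/
noncomputable def avoiding {n : ℕ} (z : Const) (w : Fin n ↪ Const) (i : Fin n) : Finset Const :=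
  (insert z (Finset.univ.map w)).erase (w i)

theorem card_avoiding {n : ℕ} {z : Const} {w : Fin n ↪ Const} (hz : ∀ i, w i ≠ z) (i : Fin n) :
    (avoiding z w i).card = n := by
  classical
  rw [avoiding, Finset.card_erase_of_mem, Finset.card_insert_of_notMem]
  · simp
  · simpa using hz
  · simp

open Classical in
/-- Every tuple has weight `n ^ (M - |X|) • b`, times the number of those `i` for which it avoids
`wᵢ` and has all its entries among `z, w₁, …, wₙ`. The factor `n ^ (M - |X|)`, where `M` is a common
upper bound for the numbers of attributes, equalises the totals of relations of different arity. -/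
noncomputable def paddingLayer {n : ℕ} (z : Const) (w : Fin n ↪ Const) (M : ℕ) (b : K)
    (X : Finset Att) : KRelation Const K X :=
  ∑ i : Fin n, ∑ t ∈ Fintype.piFinset fun _ : X => avoiding z w i,
    Finsupp.single t (n ^ (M - X.card) • b)

open Classical in
/-- The marginals of the padding layer do not depend on the relation and its attributes. -/
theorem margHom_paddingLayer {n : ℕ} {z : Const} {w : Fin n ↪ Const} (hz : ∀ i, w i ≠ z) {M : ℕ}
    (b : K) {X : Finset Att} (hX : X.card ≤ M) {m : ℕ} (L : Fin m ↪ X) (v : Fin m → Const) :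
    margHom L v (paddingLayer z w M b X)
      = ((Finset.univ.filter fun i => ∀ j, v j ∈ avoiding z w i).card * n ^ (M - m)) • b := by
  have hm : m ≤ X.card := by simpa using Fintype.card_le_of_embedding L
  have inner : ∀ i : Fin n, margHom L v (∑ t ∈ Fintype.piFinset fun _ : X => avoiding z w i,
      Finsupp.single t (n ^ (M - X.card) • b))
      = if ∀ j, v j ∈ avoiding z w i then n ^ (M - m) • b else 0 := by
    intro i
    simp only [map_sum, margHom_single]
    rw [← Finset.sum_filter, Finset.sum_const]
    split_ifs with hv
    · rw [card_piFinset_filter _ L v hv, card_avoiding hz, smul_smul, ← pow_add]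
      congr 2
      omega
    · rw [Finset.card_eq_zero.2, zero_smul]
      refine Finset.filter_eq_empty_iff.2 fun t ht h => hv fun j => ?_
      rw [← h j]
      exact Fintype.mem_piFinset.1 ht _
  rw [paddingLayer, map_sum, Finset.sum_congr rfl fun i _ => inner i, ← Finset.sum_filter,
    Finset.sum_const, smul_smul]

end Padding

/-! ### The chase layer -/

section Chase

variable {Att Rel Const K : Type*} {att : Rel → Finset Att} [AddCommMonoid K]

open Classical in
/-- For every `C` such that `R₀[A] ≤ R[C]` is derivable, the tuple of `R` that is `wᵢ` at `Cᵢ` and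
`z` elsewhere has weight `a`. -/
noncomputable def chaseLayer (Γ : Set (IND att)) (R₀ : Rel) {n : ℕ} (A : Fin n ↪ att R₀) (z : Const)
    (w : Fin n ↪ Const) (a : K) (R : Rel) : KRelation Const K (att R) :=
  ∑ C : Fin n ↪ att R with Derivable Γ ⟨R₀, R, n, A, C⟩,
    Finsupp.single (Function.extend C w fun _ => z) a

variable {Γ : Set (IND att)} {R₀ : Rel} {n : ℕ} {A : Fin n ↪ att R₀} {z : Const}
  {w : Fin n ↪ Const} {a : K} {R : Rel} {m : ℕ} {v : Fin m → Const}

theorem extend_apply_eq_iff {α : Type*} (hz : ∀ i, w i ≠ z) (C : Fin n ↪ α) (x : α) (i : Fin n) :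
    Function.extend C w (fun _ => z) x = w i ↔ x = C i := by
  constructor
  · intro h
    by_cases hx : ∃ j, C j = x
    · obtain ⟨j, rfl⟩ := hx
      rw [C.injective.extend_apply] at h
      rw [w.injective h]
    · rw [Function.extend_apply' _ _ _ hx] at h
      exact absurd h.symm (hz i)
  · rintro rfl
    exact C.injective.extend_apply ..

theorem exists_margHom_chaseLayer_eq_nsmul (L : Fin m ↪ att R) (v : Fin m → Const) :
    ∃ k : ℕ, margHom L v (chaseLayer Γ R₀ A z w a R) = k • a := by
  classical
  rw [chaseLayer, map_sum]
  simp only [margHom_single]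
  rw [← Finset.sum_filter, Finset.sum_const]
  exact ⟨_, rfl⟩

theorem margHom_chaseLayer_of_notMem (L : Fin m ↪ att R) (j : Fin m) (hz : v j ≠ z)
    (hw : ∀ i, v j ≠ w i) : margHom L v (chaseLayer Γ R₀ A z w a R) = 0 := by
  classical
  rw [chaseLayer, map_sum]
  refine Finset.sum_eq_zero fun C _ => ?_
  rw [margHom_single, if_neg]
  intro h
  have hj := h j
  by_cases hx : ∃ i, C i = L j
  · obtain ⟨i, hi⟩ := hx
    rw [← hi, C.injective.extend_apply] at hj
    exact hw i hj.symm
  · rw [Function.extend_apply' _ _ _ hx] at hj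
    exact hz hj.symm

open Classical in
/-- At a vector `v` that contains every `wᵢ`, say at position `p i`, the only tuple of the chase
layer that can project to `v` along `L` is the one given by `L ∘ p`. -/
theorem margHom_chaseLayer_of_full (hz : ∀ i, w i ≠ z) (L : Fin m ↪ att R) (p : Fin n ↪ Fin m)
    (hp : ∀ i, v (p i) = w i) :
    margHom L v (chaseLayer Γ R₀ A z w a R)
      = if Derivable Γ ⟨R₀, R, n, A, p.trans L⟩ ∧ (Function.extend p w fun _ => z) = v
        then a else 0 := by
  have huniq : ∀ C : Fin n ↪ att R,
      (∀ j, Function.extend C w (fun _ => z) (L j) = v j) → C = p.trans L := by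
    intro C h
    ext1 i
    exact ((extend_apply_eq_iff hz C _ i).1 ((h (p i)).trans (hp i))).symm
  have hself : (∀ j, Function.extend (p.trans L) w (fun _ => z) (L j) = v j) ↔
      (Function.extend p w fun _ => z) = v := by
    rw [funext_iff]
    refine forall_congr' fun j => ?_
    have : Function.extend (p.trans L) w (fun _ => z) (L j)
        = Function.extend p w (fun _ => z) j := by
      by_cases hj : ∃ i, p i = j
      · obtain ⟨i, rfl⟩ := hj
        rw [p.injective.extend_apply]
        exact (p.trans L).injective.extend_apply ..
      · rw [Function.extend_apply' _ _ _ hj, Function.extend_apply']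
        rintro ⟨i, hi⟩
        exact hj ⟨i, L.injective hi⟩
    rw [this]
  rw [chaseLayer, map_sum]
  simp only [margHom_single]
  rw [Finset.sum_filter, Finset.sum_eq_single (p.trans L)]
  · simp only [hself, ← ite_and]
  · intro C _ hC
    rw [if_neg fun h => hC (huniq C h), ite_self]
  · exact fun h => absurd (Finset.mem_univ _) h

end Chase

/-! ### Completeness -/

theorem nsmul_add_nsmul_of_add_eq {K : Type*} [AddCommMonoid K] {a b : K} (hab : a + b = b)
    (k : ℕ) {N : ℕ} (hN : N ≠ 0) : k • a + N • b = N • b := by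
  obtain ⟨N, rfl⟩ := Nat.exists_eq_succ_of_ne_zero hN
  induction k with
  | zero => rw [zero_smul, zero_add]
  | succ k ih =>
    rw [succ_nsmul, add_assoc, succ_nsmul', ← add_assoc a, hab, ← succ_nsmul', ih]

section Completeness

variable {Att Rel Const K : Type*} {att : Rel → Finset Att} [AddCommMonoid K]

/-- The sum of the chase layer and the padding layer. -/
noncomputable def counterDatabase (Γ : Set (IND att)) (R₀ : Rel) {n : ℕ} (A : Fin n ↪ att R₀)
    (z : Const) (w : Fin n ↪ Const) (a b : K) (S : Finset Rel) : KDatabase att Const K S :=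
  fun R _ => chaseLayer Γ R₀ A z w a R +
    paddingLayer z w (S.sup fun R => (att R).card) b (att R)

variable {Γ : Set (IND att)} {R₀ : Rel} {n : ℕ} {A : Fin n ↪ att R₀} {z : Const}
  {w : Fin n ↪ Const} {a b : K} {S : Finset Rel}

open Classical in
theorem marg_counterDatabase (hz : ∀ i, w i ≠ z) {R : Rel} (hR : R ∈ S) {m : ℕ}
    (L : Fin m ↪ att R) (v : Fin m → Const) :
    marg (counterDatabase Γ R₀ A z w a b S R hR) L v
      = margHom L v (chaseLayer Γ R₀ A z w a R)
        + ((Finset.univ.filter fun i => ∀ j, v j ∈ avoiding z w i).card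
          * n ^ ((S.sup fun R => (att R).card) - m)) • b := by
  rw [← margHom_eq_marg, counterDatabase, map_add, margHom_paddingLayer hz]
  exact Finset.le_sup (f := fun R => (att R).card) hR

theorem marg_counterDatabase_of_full (hz : ∀ i, w i ≠ z) {R : Rel} (hR : R ∈ S) {m : ℕ}
    (L : Fin m ↪ att R) {v : Fin m → Const} (p : Fin n → Fin m) (hp : ∀ i, v (p i) = w i) :
    marg (counterDatabase Γ R₀ A z w a b S R hR) L v
      = margHom L v (chaseLayer Γ R₀ A z w a R) := by
  classical
  rw [marg_counterDatabase hz, Finset.filter_eq_empty_iff.2, Finset.card_empty, zero_mul, zero_smul,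
    add_zero]
  intro i _ h
  have := h (p i)
  rw [hp] at this
  exact Finset.notMem_erase _ _ this

theorem satisfies_counterDatabase (hab : a + b = b) (hz : ∀ i, w i ≠ z) {σ : IND att} (hσ : σ ∈ Γ)
    (hS : σ.IsOver S) : Satisfies (counterDatabase Γ R₀ A z w a b S) σ := by
  classical
  refine ⟨hS.1, hS.2, fun v => ?_⟩
  by_cases hfull : ∀ i, ∃ j, v j = w i
  · choose p hp using hfull
    have hinj : Function.Injective p := fun i i' h => w.injective (by rw [← hp, ← hp, h])
    rw [marg_counterDatabase_of_full hz _ _ p hp, marg_counterDatabase_of_full hz _ _ p hp,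
      margHom_chaseLayer_of_full hz _ ⟨p, hinj⟩ hp, margHom_chaseLayer_of_full hz _ ⟨p, hinj⟩ hp]
    by_cases h : Derivable Γ ⟨R₀, σ.source, n, A, Function.Embedding.trans ⟨p, hinj⟩ σ.lhs⟩
    · have h' : Derivable Γ ⟨R₀, σ.target, n, A, Function.Embedding.trans ⟨p, hinj⟩ σ.rhs⟩ :=
        h.transitivity (Derivable.projection (Derivable.hyp hσ) _)
      simp only [h, h', true_and]
      exact NatLE.refl _
    · simp only [h, false_and, if_false]
      exact NatLE.zero_le _
  · push Not at hfull
    obtain ⟨i, hi⟩ := hfull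
    rw [marg_counterDatabase hz, marg_counterDatabase hz]
    by_cases hv : ∀ j, v j ∈ avoiding z w i
    · obtain ⟨k, hk⟩ := exists_margHom_chaseLayer_eq_nsmul (Γ := Γ) (A := A) (z := z) (w := w)
        (a := a) σ.lhs v
      obtain ⟨k', hk'⟩ := exists_margHom_chaseLayer_eq_nsmul (Γ := Γ) (A := A) (z := z) (w := w)
        (a := a) σ.rhs v
      have hN : (Finset.univ.filter fun i => ∀ j, v j ∈ avoiding z w i).card
          * n ^ ((S.sup fun R => (att R).card) - σ.arity) ≠ 0 :=
        mul_ne_zero (Finset.card_ne_zero_of_mem (Finset.mem_filter.2 ⟨Finset.mem_univ i, hv⟩))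
          (pow_ne_zero _ (Nat.ne_of_gt i.pos))
      rw [hk, hk', nsmul_add_nsmul_of_add_eq hab k hN, nsmul_add_nsmul_of_add_eq hab k' hN]
      exact NatLE.refl _
    · -- Some entry of `v` is none of the constants `z, w₁, …, wₙ`, so the left-hand side is `0`.
      push Not at hv
      obtain ⟨j, hj⟩ := hv
      have hj' : ¬ (v j = z ∨ ∃ k, w k = v j) := by simpa [avoiding, hi j] using hj
      push Not at hj'
      rw [margHom_chaseLayer_of_notMem _ j hj'.1 fun k h => hj'.2 k h.symm,
        Finset.filter_eq_empty_iff.2, Finset.card_empty, zero_mul, zero_smul, add_zero]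
      · exact NatLE.zero_le _
      · intro k _ h
        have hk : v j = z ∨ ∃ k, w k = v j := by
          simpa using Finset.mem_of_mem_erase (h j)
        exact hk.elim hj'.1 fun ⟨k, hk⟩ => hj'.2 k hk

end Completeness

theorem Entails.derivable {Att Rel Const K : Type*} {att : Rel → Finset Att} [AddCommMonoid K]
    [Infinite Const] (hpos : IsPositive K) (hWA : IsWeaklyAbsorptive K) {Γ : Set (IND att)}
    {τ : IND att} (hΓ : Γ.Finite) (h : Entails Const K Γ τ) : Derivable Γ τ := by
  classical
  obtain ⟨a, b, ha, -, hab⟩ := hWA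
  by_contra hτ
  let e := Infinite.natEmbedding Const
  let z : Const := e τ.arity
  let w : Fin τ.arity ↪ Const := Fin.valEmbedding.trans e
  have hz : ∀ i, w i ≠ z := fun i hi => absurd (e.injective hi) i.isLt.ne
  let S : Finset Rel :=
    hΓ.toFinset.image IND.source ∪ hΓ.toFinset.image IND.target ∪ {τ.source, τ.target}
  have hS : ∀ σ ∈ Γ, σ.IsOver S := fun σ hσ =>
    ⟨Finset.mem_union_left _ (Finset.mem_union_left _
      (Finset.mem_image_of_mem _ (hΓ.mem_toFinset.2 hσ))),
    Finset.mem_union_left _ (Finset.mem_union_right _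
      (Finset.mem_image_of_mem _ (hΓ.mem_toFinset.2 hσ)))⟩
  have hSτ : τ.IsOver S :=
    ⟨Finset.mem_union_right _ (by simp), Finset.mem_union_right _ (by simp)⟩
  obtain ⟨h₁, h₂, hle⟩ := h S hS hSτ (counterDatabase Γ τ.source τ.lhs z w a b S)
    fun σ hσ => satisfies_counterDatabase hab hz hσ (hS σ hσ)
  have hw : (Function.extend (Function.Embedding.refl (Fin τ.arity)) w fun _ => z) = w :=
    funext fun i => (Function.Embedding.refl _).injective.extend_apply w _ i
  obtain ⟨c, hc⟩ := hle w
  rw [marg_counterDatabase_of_full hz h₁ τ.lhs _ fun _ => rfl,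
    marg_counterDatabase_of_full hz h₂ τ.rhs _ fun _ => rfl,
    margHom_chaseLayer_of_full hz τ.lhs (Function.Embedding.refl _) fun _ => rfl,
    margHom_chaseLayer_of_full hz τ.rhs (Function.Embedding.refl _) fun _ => rfl,
    if_pos ⟨Derivable.reflexivity _ _, hw⟩, if_neg fun h => hτ h.1] at hc
  exact ha (hpos a c hc).1

end KInd

theorem mainTheorem2 {Att Rel Const : Type*}
    [Countable Att] [Infinite Att] [Countable Rel] [Infinite Rel] [Countable Const] [Infinite Const]
    (att : Rel → Finset Att)
    {K : Type*} [AddCommMonoid K]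
    (hpos : KInd.IsPositive K) (hWA : KInd.IsWeaklyAbsorptive K) :
    -- soundness
    (∀ (Γ : Set (KInd.IND att)) (τ : KInd.IND att), Γ.Finite →
      KInd.Derivable Γ τ → KInd.Entails Const K Γ τ) ∧
    -- completeness
    (∀ (Γ : Set (KInd.IND att)) (τ : KInd.IND att), Γ.Finite →
      KInd.Entails Const K Γ τ → KInd.Derivable Γ τ) := by
  exact ⟨fun Γ τ _ h S _ hτ D hD => h.satisfies hD hτ.1,
    fun Γ τ hΓ h => h.derivable hpos hWA hΓ⟩
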